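/- **Setting.** Fix an integer $n\ge 1$, let $\mathcal C_n=\{0,\frac1n,\dots,1\}$, and fix either the Gödel truth functions ($a\otimes b=\min\{a,b\}$, $a\oplus b=\max\{a,b\}$, $a\rhd b=1$ if $a\le b$ and $b$ otherwise) or the Łukasiewicz ones ($a\otimes b=\max\{a+b-1,0\}$, $a\oplus b=\min\{a+b,1\}$, $a\rhd b=\min\{1-a+b,1\}$), in both cases with $\ominus a=1-a$. Concepts are built from concept names, $\top,\bot$ by $\sqcap,\sqcup,\neg$. An interpretation $I$ has a non-empty domain $\Delta$, elements $a^I\in\Delta$ for the individual names $a$, and functions $A^I:\Delta\to\mathcal C_n$ for the concept names $A$, extended to all concepts by $\otimes,\oplus,\ominus$. A typical $C$-element of $I$ is an $x\in\Delta$ with $C^I(x)>0$ such that no $z\in\Delta$ has $C^I(z)>C^I(x)$. Let $\theta\in\{\ge,\le,>,<\}$ and $\alpha\in[0,1]$. $I$ satisfies $E\sqsubseteq F\;\theta\;\alpha$ if $(E^I(x)\rhd F^I(x))\;\theta\;\alpha$ for all $x\in\Delta$; it satisfies $E(a)\;\theta\;\alpha$ if $E^I(a^I)\;\theta\;\alpha$;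 it satisfies $\mathbf T(C)\sqsubseteq D\;\theta\;\alpha$ if $D^I(x)\;\theta\;\alpha$ for every typical $C$-element $x$, and otherwise falsifies it. A weighted knowledge base $K$ consists of a finite set $\mathcal T$ of inclusions $E\sqsubseteq F\;\theta\;\alpha$, a finite set $\mathcal A$ of assertions $E(a)\;\theta\;\alpha$, finitely many distinguished concepts $C_1,\dots,C_m$ and, for each $C_i$, a finite set of typicality inclusions $\mathbf T(C_i)\sqsubseteq D_{i,h}$ with weights $w^i_h\in\mathbb R$. Let $\varphi:\mathbb R\to[0,1]$ be non-decreasing, and let $\varphi_n(x)$ be $0$ if $\varphi(x)\le\frac1{2n}$, $\frac in$ if $\frac{2i-1}{2n}<\varphi(x)\le\frac{2i+1}{2n}$ with $0<i<n$, and $1$ if $\varphi(x)>\frac{2n-1}{2n}$. A $\varphi_n$-coherent model of $K$ is an interpretation that satisfies $\mathcal T$ and $\mathcal A$ and has $C_i^I(x)=\varphi_n\bigl(\sum_h w^i_hD_{i,h}^I(x)\bigr)$ for all $i$ and $x$. It is canonical if for every $\varphi_n$-coherent model $J$ of $K$ and every $y\in\Delta^J$ there is $z\in\Delta$ with $B^I(z)=B^J(y)$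 for all concept names $B$ occurring in $K$. **The program.** Assume that all weights have at most $k$ decimal places, so that $w'=10^kw$ is an integer for every weight $w$. For concepts $C,D$, the program $\Pi(K,n,C,D,\theta,\alpha)$, with integer $v\in\{0,\dots,n\}$ standing for $\frac vn$ and concepts $E$ represented by terms $E'$, has: facts $val(v)$ for $0\le v\le n$; $nom(a)$ for the individual names of $K$; $nom(aux_C)$; $auxtc(aux_C,C')$; $cls(A)$ for the concept names $A$ of $K$, $C$, $D$; $dcls(C_i')$; $subTyp(C_i',D_{i,h}',w'^i_h)$; $concept(E')$ for the concepts $E$ of $K$ and for $C,D$, with rules that propagate $concept$ to subconcepts; the choice rule $1\{inst(X,A,V):val(V)\}1\leftarrow cls(A),nom(X)$; rules that derive $eval(E',X,V)$ from the $inst$ atoms by the truth functions of the chosen logic rescaled to $\{0,\dots,n\}$; a constraint for each assertion $E(a)\,\theta'\,\beta$ in $\mathcal A$, excluding $eval(E',a,V)$ unless $V\,\theta'\,\beta n$, and for each inclusion $E\sqsubseteq F\,\theta'\,\beta$ in $\mathcal T$, excluding $eval(E',X,V_1),eval(F',X,V_2)$ unless the rescaled value of $V_1\rhd V_2$ stands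 in relation $\theta'$ to $\beta n$; for each $i$ a rule deriving $weight(X,C_i',W)$ with $W=\sum_h w'^i_hV_h$ from $nom(X)$ and, for all $h$, $subTyp(C_i',D_{i,h}',w'^i_h)$ and $eval(D_{i,h}',X,V_h)$; rules $num(W)\leftarrow nom(X),weight(X,E,W),dcls(E)$ and $valphi(n,W,V)\leftarrow num(W)$ for $V=n\,\varphi_n\bigl(W/(n10^k)\bigr)$; the constraint $\bot\leftarrow nom(X),dcls(E),eval(E,X,V),weight(X,E,W),valphi(n,W,V_1),V\ne V_1$; and $ok\leftarrow eval(D',aux_C,V),\,V\,\theta\,\alpha n$ and $notok\leftarrow not\ ok$. An answer set $S$ is preferred if there is no answer set $S'$ with $eval(C',aux_C,v')\in S'$, $eval(C',aux_C,v)\in S$ and $v'>v$. **Proposition.** Assume that every concept name occurring in $C$ occurs in $K$, and that, if $K$ has a $\varphi_n$-coherent model at all, then $C^I(x)>0$ for some $\varphi_n$-coherent model $I$ of $K$ and some $x$ in its domain. Then the query $\mathbf T(C)\sqsubseteq D\;\theta\;\alpha$ is falsified in some canonical $\varphi_n$-coherent model of $K$ if and only if there is a preferred answer set $S$ of $\Pi(K,n,C,D,\theta,\alpha)$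 that contains $eval(D',aux_C,v)$ for some $v$ such that $v\;\theta\;\alpha n$ does not hold. Moreover, every such preferred answer set contains $notok$. -/

import Mathlib

universe u v w

namespace MVDL

/-! ### Syntax and many-valued semantics of the boolean description logic -/

/-- The two families of truth functions: Gödel (with involutive negation) and Łukasiewicz. -/
inductive Family
  | godel
  | lukasiewicz

/-- The t-norm `⊗`. -/
noncomputable def Family.tnorm : Family → ℝ → ℝ → ℝ
  | .godel, a, b => min a b
  | .lukasiewicz, a, b => max (a + b - 1) 0

/-- The s-norm `⊕`. -/
noncomputable def Family.snorm : Family → ℝ → ℝ → ℝ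
  | .godel, a, b => max a b
  | .lukasiewicz, a, b => min (a + b) 1

/-- The implication function `▷`. -/
noncomputable def Family.impl : Family → ℝ → ℝ → ℝ
  | .godel, a, b => if a ≤ b then 1 else b
  | .lukasiewicz, a, b => min (1 - a + b) 1

/-- The comparison symbols `θ ∈ {≥, ≤, >, <}`. -/
inductive Cmp
  | ge
  | le
  | gt
  | lt

/-- `θ.Holds a b` is `a θ b`. -/
def Cmp.Holds : Cmp → ℝ → ℝ → Prop
  | .ge, a, b => a ≥ b
  | .le, a, b => a ≤ b
  | .gt, a, b => a > b
  | .lt, a, b => a < b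

/-- Boolean concepts over the concept names `NC`. The same type serves as the type of the ground
terms `and(C', D')`, `or(C', D')`, `neg(C')`, … that represent concepts in a program. -/
inductive BConcept (NC : Type v) : Type v
  | name (A : NC)
  | top
  | bot
  | and (C D : BConcept NC)
  | or (C D : BConcept NC)
  | neg (C : BConcept NC)

/-- The concept names occurring in a concept. -/
def BConcept.names {NC : Type v} : BConcept NC → Set NC
  | .name A => {A}
  | .top => ∅
  | .bot => ∅
  | .and C D => C.names ∪ D.names
  | .or C D => C.names ∪ D.names
  | .neg C => C.names

/-- The truth space `{0, 1/n, …, n/n}`. -/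
def truthSpace (n : ℕ) : Set ℝ := {r | ∃ i : ℕ, i ≤ n ∧ r = (i : ℝ) / n}

/-- A finitely many-valued interpretation over the truth space `{0, 1/n, …, 1}`. -/
structure Interp (NC : Type v) (NI : Type w) (n : ℕ) : Type (max (u + 1) v w) where
  Dom : Type u
  dom_nonempty : Nonempty Dom
  ind : NI → Dom
  conc : NC → Dom → ℝ
  conc_mem : ∀ A x, conc A x ∈ truthSpace n

namespace Interp

variable {NC : Type v} {NI : Type w} {n : ℕ}

/-- The membership degree `C^I(x)`. -/
noncomputable def deg (I : Interp.{u} NC NI n) (L : Family) : BConcept NC → I.Dom → ℝ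
  | .name A, x => I.conc A x
  | .top, _ => 1
  | .bot, _ => 0
  | .and C D, x => L.tnorm (I.deg L C x) (I.deg L D x)
  | .or C D, x => L.snorm (I.deg L C x) (I.deg L D x)
  | .neg C, x => 1 - I.deg L C x

/-- The induced preference `x <_C y`, i.e. `C^I(x) > C^I(y)`. -/
def Pref (I : Interp.{u} NC NI n) (L : Family) (C : BConcept NC) (x y : I.Dom) : Prop :=
  I.deg L C x > I.deg L C y

/-- `x` is a typical `C`-element: a `<_C`-minimal element of `{y | C^I(y) > 0}`. -/
def Typical (I : Interp.{u} NC NI n) (L : Family) (C : BConcept NC) (x : I.Dom) : Prop :=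
  0 < I.deg L C x ∧ ¬ ∃ z : I.Dom, 0 < I.deg L C z ∧ I.Pref L C z x

/-- `I` satisfies the typicality inclusion `T(C) ⊑ D θ α`: every typical `C`-element is an
instance of `D` with a degree `d` such that `d θ α`. -/
def SatTypIncl (I : Interp.{u} NC NI n) (L : Family) (C D : BConcept NC) (θ : Cmp) (α : ℝ) :
    Prop :=
  ∀ x : I.Dom, I.Typical L C x → θ.Holds (I.deg L D x) α

end Interp

/-! ### Weighted knowledge bases -/

/-- A strict inclusion axiom `lhs ⊑ rhs θ α`, with `α ∈ [0,1]`. -/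
structure Incl (NC : Type v) : Type v where
  lhs : BConcept NC
  rhs : BConcept NC
  cmp : Cmp
  bound : Set.Icc (0 : ℝ) 1

/-- An assertion `C(a) θ α`, with `α ∈ [0,1]`. -/
structure Assertion (NC : Type v) (NI : Type w) : Type (max v w) where
  conc : BConcept NC
  ind : NI
  cmp : Cmp
  bound : Set.Icc (0 : ℝ) 1

/-- A weighted knowledge base: a TBox, an ABox, the set `dist` of distinguished concepts, and for
each distinguished concept `C` the finite set `typ C` of the pairs `(D, w)` such that
`T(C) ⊑ D` is a typicality inclusion with weight `w`. (`typ C` is never used for `C ∉ dist`.) -/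
structure KB (NC : Type v) (NI : Type w) : Type (max v w) where
  tbox : Finset (Incl NC)
  abox : Finset (Assertion NC NI)
  dist : Finset (BConcept NC)
  typ : BConcept NC → Finset (BConcept NC × ℝ)

namespace KB

variable {NC : Type v} {NI : Type w}

/-- The concepts that occur (not as proper subconcepts) in the knowledge base. -/
def concepts (K : KB NC NI) : Set (BConcept NC) :=
  {E | (∃ i ∈ K.tbox, E = i.lhs ∨ E = i.rhs) ∨ (∃ a ∈ K.abox, E = a.conc) ∨ E ∈ K.dist ∨
    ∃ C ∈ K.dist, ∃ p ∈ K.typ C, E = p.1}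

/-- The concept names occurring in the knowledge base. -/
def names (K : KB NC NI) : Set NC := {A | ∃ E ∈ K.concepts, A ∈ E.names}

/-- The individual names occurring in the knowledge base. -/
def inds (K : KB NC NI) : Set NI := {a | ∃ s ∈ K.abox, s.ind = a}

/-- The weights of the typicality inclusions are decimal numbers with `k` decimal places. -/
def HasDecimalWeights (K : KB NC NI) (k : ℕ) : Prop :=
  ∀ C ∈ K.dist, ∀ p ∈ K.typ C, ∃ z : ℤ, p.2 * 10 ^ k = z

end KB

namespace Interp

variable {NC : Type v} {NI : Type w} {n : ℕ}

/-- `I` satisfies a strict inclusion `E ⊑ D θ α`: `E^I(x) ▷ D^I(x) θ α` for all `x`. For `≥` and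
`>` this is the same as comparing `inf_x (E^I(x) ▷ D^I(x))` with `α`, since the infimum over the
finite truth space is attained. -/
def SatIncl (I : Interp.{u} NC NI n) (L : Family) (i : Incl NC) : Prop :=
  ∀ x : I.Dom, i.cmp.Holds (L.impl (I.deg L i.lhs x) (I.deg L i.rhs x)) i.bound

/-- `I` satisfies an assertion `C(a) θ α`. -/
def SatAssertion (I : Interp.{u} NC NI n) (L : Family) (s : Assertion NC NI) : Prop :=
  s.cmp.Holds (I.deg L s.conc (I.ind s.ind)) s.bound

/-- `f`-coherence: `C^I(x) = f (∑_h w_h D_h^I(x))` for every distinguished `C` and every `x`. -/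
def Coherent (I : Interp.{u} NC NI n) (L : Family) (f : ℝ → ℝ) (K : KB NC NI) : Prop :=
  ∀ C ∈ K.dist, ∀ x : I.Dom, I.deg L C x = f (∑ p ∈ K.typ C, p.2 * I.deg L p.1 x)

/-- `I` is an `f`-coherent model of `K`. -/
def IsModel (I : Interp.{u} NC NI n) (L : Family) (f : ℝ → ℝ) (K : KB NC NI) : Prop :=
  (∀ i ∈ K.tbox, I.SatIncl L i) ∧ (∀ s ∈ K.abox, I.SatAssertion L s) ∧ I.Coherent L f K

/-- `I` is a canonical `f`-coherent model of `K`. -/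
def IsCanonical (I : Interp.{u} NC NI n) (L : Family) (f : ℝ → ℝ) (K : KB NC NI) : Prop :=
  I.IsModel L f K ∧
    ∀ J : Interp.{u} NC NI n, J.IsModel L f K → ∀ y : J.Dom,
      ∃ z : I.Dom, ∀ B ∈ K.names, I.conc B z = J.conc B y

end Interp

/-- The approximation `φ_n` of `φ` over `{0, 1/n, …, 1}`. In the middle case `⌈n φ(x) - 1/2⌉` is
the integer `i` with `(2i - 1)/(2n) < φ(x) ≤ (2i + 1)/(2n)`, see `phiN_eq`. -/
noncomputable def phiN (φ : ℝ → ℝ) (n : ℕ) (x : ℝ) : ℝ :=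
  if φ x ≤ 1 / (2 * n) then 0
  else if (2 * n - 1) / (2 * n) < φ x then 1
  else (⌈(n : ℝ) * φ x - 1 / 2⌉ : ℝ) / n

theorem phiN_eq (φ : ℝ → ℝ) (n : ℕ) (x : ℝ) (i : ℕ) (hi : 0 < i) (hin : i < n)
    (h1 : (2 * (i : ℝ) - 1) / (2 * n) < φ x) (h2 : φ x ≤ (2 * (i : ℝ) + 1) / (2 * n)) :
    phiN φ n x = i / n := by
  have hn : (0 : ℝ) < 2 * n := by
    have : 0 < n := by omega
    positivity
  have hi' : (1 : ℝ) ≤ i := by exact_mod_cast hi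
  have hin' : (i : ℝ) + 1 ≤ n := by exact_mod_cast hin
  rw [div_lt_iff₀ hn] at h1
  rw [le_div_iff₀ hn] at h2
  have e1 : ¬ φ x ≤ 1 / (2 * n) := by
    rw [le_div_iff₀ hn]; linarith
  have e2 : ¬ (2 * (n : ℝ) - 1) / (2 * n) < φ x := by
    rw [div_lt_iff₀ hn]; linarith
  have e3 : ⌈(n : ℝ) * φ x - 1 / 2⌉ = (i : ℤ) := by
    rw [Int.ceil_eq_iff]
    push_cast
    constructor <;> linarith
  rw [phiN, if_neg e1, if_neg e2, e3]
  simp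

/-! ### Answer sets of ground programs -/

/-- Rule heads: an atom, the empty head `⊥` of a constraint, or `1{s}1`. -/
inductive Head (α : Type u) : Type u
  | atom (a : α)
  | falsum
  | exactlyOne (s : Set α)

/-- A ground rule `head ← pos, not neg`. -/
structure GRule (α : Type u) : Type u where
  head : Head α
  pos : Set α
  neg : Set α

/-- The head is satisfied by the set `S` of atoms. -/
def Head.Sat {α : Type u} (S : Set α) : Head α → Prop
  | .atom a => a ∈ S
  | .falsum => False
  | .exactlyOne s => ∃! a, a ∈ s ∧ a ∈ S

/-- `S` satisfies the rule `r`. -/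
def GRule.Sat {α : Type u} (S : Set α) (r : GRule α) : Prop :=
  r.pos ⊆ S → Disjoint r.neg S → r.head.Sat S

/-- The atoms that a head supports relative to `S`: for a choice head, its elements that are
in `S`. -/
def Head.supported {α : Type u} (S : Set α) : Head α → Set α
  | .atom a => {a}
  | .falsum => ∅
  | .exactlyOne s => s ∩ S

/-- `M` is closed under the reduct of `P` relative to `S`, i.e. under the definite rules
`a ← r.pos`, for the rules `r` of `P` whose negative body holds in `S` and the atoms `a` supported
by the head of `r`. -/
def ReductClosed {α : Type u} (P : Set (GRule α)) (S M : Set α) : Prop :=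
  ∀ r ∈ P, Disjoint r.neg S → r.pos ⊆ M → r.head.supported S ⊆ M

/-- `S` is an answer set (stable model) of `P`: it satisfies all the rules of `P` and is the least
model of the reduct of `P` relative to `S`. -/
def IsAnswerSet {α : Type u} (P : Set (GRule α)) (S : Set α) : Prop :=
  (∀ r ∈ P, r.Sat S) ∧ S = ⋂₀ {M | ReductClosed P S M}

/-! ### The encoding -/

/-- The constants that denote domain elements: individual names and `aux_C`. -/
inductive Const (NI : Type w) : Type w
  | ind (a : NI)
  | aux

/-- The ground atoms of the encoding. -/
inductive Atom (NC : Type v) (NI : Type w) : Type (max v w)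
  | val (i : ℤ)
  | nom (x : Const NI)
  | cls (A : NC)
  | concept (E : BConcept NC)
  | dcls (C : BConcept NC)
  | subTyp (C D : BConcept NC) (w : ℤ)
  | inst (x : Const NI) (A : NC) (i : ℤ)
  | eval (E : BConcept NC) (x : Const NI) (i : ℤ)
  | weight (x : Const NI) (C : BConcept NC) (w : ℤ)
  | num (w : ℤ)
  | valphi (w i : ℤ)
  | auxtc (x : Const NI) (C : BConcept NC)
  | ok
  | notok

/-- The t-norm on `{0, …, n}`, with `i` standing for `i / n`. -/
def Family.tnormZ (n : ℤ) : Family → ℤ → ℤ → ℤ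
  | .godel, a, b => min a b
  | .lukasiewicz, a, b => max (a + b - n) 0

/-- The s-norm on `{0, …, n}`. -/
def Family.snormZ (n : ℤ) : Family → ℤ → ℤ → ℤ
  | .godel, a, b => max a b
  | .lukasiewicz, a, b => min (a + b) n

/-- The implication function on `{0, …, n}`. -/
def Family.implZ (n : ℤ) : Family → ℤ → ℤ → ℤ
  | .godel, a, b => if a ≤ b then n else b
  | .lukasiewicz, a, b => min (n - a + b) n

/-- The integer that represents a weight `w` up to `k` decimal places. -/
noncomputable def weightInt (k : ℕ) (w : ℝ) : ℤ := round (w * 10 ^ k)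

/-- A fact. -/
def GRule.fact {α : Type u} (a : α) : GRule α := ⟨.atom a, ∅, ∅⟩

/-- A definite rule. -/
def GRule.rule {α : Type u} (a : α) (B : Set α) : GRule α := ⟨.atom a, B, ∅⟩

/-- A constraint. -/
def GRule.constraint {α : Type u} (B : Set α) : GRule α := ⟨.falsum, B, ∅⟩

section Encoding

variable {NC : Type v} {NI : Type w}

open Atom GRule

/-- The ground instances of the rules of the program `Π(K, n, C, D, θ, α)`; `k` is the number of
decimal places of the weights. Arithmetic and comparisons are evaluated when grounding. -/
inductive EncRule (L : Family) (φ : ℝ → ℝ) (n k : ℕ) (K : KB NC NI) (C D : BConcept NC)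
    (θ : Cmp) (α : ℝ) : GRule (Atom NC NI) → Prop
  -- facts describing the knowledge base and the query
  | val (i : ℤ) (h0 : 0 ≤ i) (hn : i ≤ n) : EncRule L φ n k K C D θ α (fact (val i))
  | nom (a : NI) (ha : a ∈ K.inds) : EncRule L φ n k K C D θ α (fact (nom (.ind a)))
  | nomAux : EncRule L φ n k K C D θ α (fact (nom .aux))
  | auxtc : EncRule L φ n k K C D θ α (fact (auxtc .aux C))
  | cls (A : NC) (hA : A ∈ K.names ∪ C.names ∪ D.names) :
      EncRule L φ n k K C D θ α (fact (cls A))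
  | dcls (E : BConcept NC) (hE : E ∈ K.dist) : EncRule L φ n k K C D θ α (fact (dcls E))
  | subTyp (E : BConcept NC) (hE : E ∈ K.dist) (p : BConcept NC × ℝ) (hp : p ∈ K.typ E) :
      EncRule L φ n k K C D θ α (fact (subTyp E p.1 (weightInt k p.2)))
  -- concepts of interest
  | concept (E : BConcept NC) (hE : E ∈ K.concepts ∨ E = C ∨ E = D) :
      EncRule L φ n k K C D θ α (fact (concept E))
  | conceptAndL (E F : BConcept NC) :
      EncRule L φ n k K C D θ α (rule (concept E) {concept (.and E F)})
  | conceptAndR (E F : BConcept NC) :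
      EncRule L φ n k K C D θ α (rule (concept F) {concept (.and E F)})
  | conceptOrL (E F : BConcept NC) :
      EncRule L φ n k K C D θ α (rule (concept E) {concept (.or E F)})
  | conceptOrR (E F : BConcept NC) :
      EncRule L φ n k K C D θ α (rule (concept F) {concept (.or E F)})
  | conceptNeg (E : BConcept NC) :
      EncRule L φ n k K C D θ α (rule (concept E) {concept (.neg E)})
  -- `1{inst(X,A,V) : val(V)}1 ← cls(A), nom(X)`
  | choice (A : NC) (x : Const NI) :
      EncRule L φ n k K C D θ α
        ⟨.exactlyOne {a | ∃ i : ℤ, 0 ≤ i ∧ i ≤ n ∧ a = inst x A i}, {cls A, nom x}, ∅⟩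
  -- evaluation of concepts
  | evalName (A : NC) (x : Const NI) (i : ℤ) :
      EncRule L φ n k K C D θ α (rule (eval (.name A) x i) {cls A, inst x A i})
  | evalTop (x : Const NI) :
      EncRule L φ n k K C D θ α (rule (eval .top x n) {concept .top, nom x})
  | evalBot (x : Const NI) :
      EncRule L φ n k K C D θ α (rule (eval .bot x 0) {concept .bot, nom x})
  | evalAnd (E F : BConcept NC) (x : Const NI) (i j : ℤ) :
      EncRule L φ n k K C D θ α
        (rule (eval (.and E F) x (L.tnormZ n i j)) {concept (.and E F), eval E x i, eval F x j})
  | evalOr (E F : BConcept NC) (x : Const NI) (i j : ℤ) :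
      EncRule L φ n k K C D θ α
        (rule (eval (.or E F) x (L.snormZ n i j)) {concept (.or E F), eval E x i, eval F x j})
  | evalNeg (E : BConcept NC) (x : Const NI) (i : ℤ) :
      EncRule L φ n k K C D θ α (rule (eval (.neg E) x (n - i)) {concept (.neg E), eval E x i})
  -- constraints for the assertions and the strict inclusions
  | abox (s : Assertion NC NI) (hs : s ∈ K.abox) (i : ℤ)
      (h : ¬ s.cmp.Holds (i : ℝ) (s.bound * n)) :
      EncRule L φ n k K C D θ α (constraint {eval s.conc (.ind s.ind) i})
  | tbox (t : Incl NC) (ht : t ∈ K.tbox) (x : Const NI) (i j : ℤ)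
      (h : ¬ t.cmp.Holds (L.implZ n i j : ℝ) (t.bound * n)) :
      EncRule L φ n k K C D θ α (constraint {eval t.lhs x i, eval t.rhs x j})
  -- weighted sums, one rule for each distinguished concept
  | weight (E : BConcept NC) (hE : E ∈ K.dist) (x : Const NI) (V : BConcept NC × ℝ → ℤ) :
      EncRule L φ n k K C D θ α
        (rule (weight x E (∑ p ∈ K.typ E, weightInt k p.2 * V p))
          ({nom x} ∪ {a | ∃ p ∈ K.typ E, a = subTyp E p.1 (weightInt k p.2) ∨
            a = eval p.1 x (V p)}))
  | num (x : Const NI) (E : BConcept NC) (W : ℤ) :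
      EncRule L φ n k K C D θ α (rule (num W) {nom x, weight x E W, dcls E})
  -- `valphi(n,W,V)` for `V = n * φ_n(W / (n * 10^k))`
  | valphi (W i : ℤ) (h : (i : ℝ) = n * phiN φ n ((W : ℝ) / (n * 10 ^ k))) :
      EncRule L φ n k K C D θ α (rule (valphi W i) {num W})
  -- coherence
  | coherence (x : Const NI) (E : BConcept NC) (i j W : ℤ) (h : i ≠ j) :
      EncRule L φ n k K C D θ α
        (constraint {nom x, dcls E, eval E x i, weight x E W, valphi W j})
  -- the query
  | ok (i : ℤ) (h : θ.Holds (i : ℝ) (α * n)) :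
      EncRule L φ n k K C D θ α (rule ok {eval D .aux i})
  | notok : EncRule L φ n k K C D θ α ⟨.atom notok, ∅, {ok}⟩

/-- The program `Π(K, n, C, D, θ, α)`, grounded. -/
def encoding (L : Family) (φ : ℝ → ℝ) (n k : ℕ) (K : KB NC NI) (C D : BConcept NC)
    (θ : Cmp) (α : ℝ) : Set (GRule (Atom NC NI)) :=
  {r | EncRule L φ n k K C D θ α r}

/-- The concept-wise preference: `S` is better than `S'` if the membership degree of `aux_C` in
the concept `E` with `auxtc(aux_C, E)` is higher in `S` than in `S'`. -/
def Better (S S' : Set (Atom NC NI)) : Prop :=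
  ∃ E : BConcept NC, auxtc .aux E ∈ S ∧
    ∃ i j : ℤ, eval E .aux i ∈ S ∧ eval E .aux j ∈ S' ∧ i > j

/-- A preferred answer set: an answer set such that no answer set is better. -/
def IsPreferred (P : Set (GRule (Atom NC NI))) (S : Set (Atom NC NI)) : Prop :=
  IsAnswerSet P S ∧ ¬ ∃ S', IsAnswerSet P S' ∧ Better S' S

end Encoding

end MVDL

/-! Strict inclusions and coherence constrain the elements of a model one at a time, and only
through the degrees of concept names. Scaled by `n`, an element is an integer valuation subject to a
local condition (`KB.Admits`), and a model is a family of such valuations in which those of the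
individuals also respect the assertions (`Interp.isModel_iff`).

The program guesses one valuation for each individual of `K` and one for `aux_C`. All other atoms
are then determined, and the constraints say that the guess is admitted. So an admitted guess yields
an answer set (`isAnswerSet_derivableSet`), and an answer set yields an admitted guess that fixes
its `eval` atoms (`IsAnswerSet.exists_valuation`).

If some guess is admitted, the admitted valuations of a finite set of names form a canonical model
(`exists_canonical`). Every canonical model realizes each valuation of the names of `K` that occurs
in any model, and `C` uses only such names. Its maximal degree of `C` is therefore the maximal value
of `C` at `aux_C` over all answer sets. A typical element placed at `aux_C` gives a preferred answer
set; conversely, the `aux_C` valuation of a preferred answer set is realized by a typical element.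
Only the latter direction needs the positivity hypothesis, as preference alone does not make the
maximum positive. -/

namespace MVDL

variable {NC : Type v} {NI : Type w}

/-! ### Integer-valued evaluation -/

/-- The value of a concept on `{0, …, n}` under an assignment of integers to concept names. -/
def BConcept.evalZ (L : Family) (n : ℕ) (f : NC → ℤ) : BConcept NC → ℤ
  | .name A => f A
  | .top => n
  | .bot => 0
  | .and C D => L.tnormZ n (C.evalZ L n f) (D.evalZ L n f)
  | .or C D => L.snormZ n (C.evalZ L n f) (D.evalZ L n f)
  | .neg C => n - C.evalZ L n f

theorem BConcept.evalZ_congr (L : Family) (n : ℕ) {f g : NC → ℤ} (E : BConcept NC)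
    (h : ∀ A ∈ E.names, f A = g A) : E.evalZ L n f = E.evalZ L n g := by
  induction E with
  | name A => exact h A rfl
  | top => rfl
  | bot => rfl
  | and E F ihE ihF =>
    simp only [evalZ, ihE fun A hA => h A (Or.inl hA), ihF fun A hA => h A (Or.inr hA)]
  | or E F ihE ihF =>
    simp only [evalZ, ihE fun A hA => h A (Or.inl hA), ihF fun A hA => h A (Or.inr hA)]
  | neg E ih => simp only [evalZ, ih h]

theorem Family.tnormZ_div (L : Family) {n : ℕ} (hn : 0 < n) (a b : ℤ) :
    L.tnorm ((a : ℝ) / n) ((b : ℝ) / n) = (L.tnormZ n a b : ℝ) / n := by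
  have hn' : (0 : ℝ) < n := by exact_mod_cast hn
  cases L with
  | godel => simp only [tnorm, tnormZ, Int.cast_min, min_div_div_right hn'.le]
  | lukasiewicz =>
    simp only [tnorm, tnormZ]
    push_cast
    rw [← max_div_div_right hn'.le]
    congr 1
    · field_simp
    · simp

theorem Family.snormZ_div (L : Family) {n : ℕ} (hn : 0 < n) (a b : ℤ) :
    L.snorm ((a : ℝ) / n) ((b : ℝ) / n) = (L.snormZ n a b : ℝ) / n := by
  have hn' : (0 : ℝ) < n := by exact_mod_cast hn
  cases L with
  | godel => simp only [snorm, snormZ, Int.cast_max, max_div_div_right hn'.le]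
  | lukasiewicz =>
    simp only [snorm, snormZ]
    push_cast
    rw [← min_div_div_right hn'.le]
    congr 1 <;> field_simp

theorem Family.implZ_div (L : Family) {n : ℕ} (hn : 0 < n) (a b : ℤ) :
    L.impl ((a : ℝ) / n) ((b : ℝ) / n) = (L.implZ n a b : ℝ) / n := by
  have hn' : (0 : ℝ) < n := by exact_mod_cast hn
  cases L with
  | godel =>
    simp only [impl, implZ, div_le_div_iff_of_pos_right hn', Int.cast_le]
    split_ifs
    · simp [hn'.ne']
    · rfl
  | lukasiewicz =>
    simp only [impl, implZ]
    push_cast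
    rw [← min_div_div_right hn'.le]
    congr 1 <;> field_simp

theorem Cmp.holds_div (θ : Cmp) {n : ℕ} (hn : 0 < n) (a b : ℝ) :
    θ.Holds (a / n) b ↔ θ.Holds a (b * n) := by
  have hn' : (0 : ℝ) < n := by exact_mod_cast hn
  cases θ with
  | ge => exact le_div_iff₀ hn'
  | le => exact div_le_iff₀ hn'
  | gt => exact lt_div_iff₀ hn'
  | lt => exact div_lt_iff₀ hn'

/-- The coherence constraint can only fire in the presence of a `valphi` atom, which carries an
integer; integrality guarantees that this atom exists. -/
theorem exists_int_eq_mul_phiN (φ : ℝ → ℝ) {n : ℕ} (hn : 0 < n) (x : ℝ) :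
    ∃ i : ℤ, (i : ℝ) = n * phiN φ n x := by
  have hn' : (n : ℝ) ≠ 0 := by exact_mod_cast hn.ne'
  unfold phiN
  split_ifs
  · exact ⟨0, by simp⟩
  · exact ⟨n, by simp⟩
  · exact ⟨_, (mul_div_cancel₀ _ hn').symm⟩

/-- All truth functions commute with division by `n`. Agreement is demanded only on the names of
`E`, because the canonical model matches a prescribed valuation only on finitely many names. -/
theorem Interp.deg_eq_evalZ_div {n : ℕ} (hn : 0 < n) (I : Interp.{u} NC NI n) (L : Family)
    (x : I.Dom) (f : NC → ℤ) (E : BConcept NC)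
    (h : ∀ A ∈ E.names, I.conc A x = (f A : ℝ) / n) :
    I.deg L E x = (E.evalZ L n f : ℝ) / n := by
  have hn' : (n : ℝ) ≠ 0 := by exact_mod_cast hn.ne'
  induction E with
  | name A => exact h A rfl
  | top => simp [deg, BConcept.evalZ, hn']
  | bot => simp [deg, BConcept.evalZ]
  | and E F ihE ihF =>
    rw [deg, BConcept.evalZ, ihE fun A hA => h A (Or.inl hA), ihF fun A hA => h A (Or.inr hA),
      L.tnormZ_div hn]
  | or E F ihE ihF =>
    rw [deg, BConcept.evalZ, ihE fun A hA => h A (Or.inl hA), ihF fun A hA => h A (Or.inr hA),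
      L.snormZ_div hn]
  | neg E ih =>
    rw [deg, BConcept.evalZ, ih h]
    push_cast
    field_simp

/-! ### Valuations that satisfy the knowledge base locally -/

/-- The scaled weighted sum of the distinguished concept `E` under the valuation `f`. -/
noncomputable def KB.weightedSum (K : KB NC NI) (L : Family) (n k : ℕ) (f : NC → ℤ)
    (E : BConcept NC) : ℤ :=
  ∑ p ∈ K.typ E, weightInt k p.2 * p.1.evalZ L n f

/-- The strict inclusions and the coherence condition hold at an element with valuation `f`. -/
def KB.Admits (K : KB NC NI) (L : Family) (φ : ℝ → ℝ) (n k : ℕ) (f : NC → ℤ) : Prop :=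
  (∀ t ∈ K.tbox, t.cmp.Holds (L.implZ n (t.lhs.evalZ L n f) (t.rhs.evalZ L n f) : ℝ)
    (t.bound * n)) ∧
  ∀ E ∈ K.dist, (E.evalZ L n f : ℝ) =
    n * phiN φ n ((K.weightedSum L n k f E : ℝ) / (n * 10 ^ k))

/-- The assertions hold if the individual `a` has valuation `v a`. -/
def KB.AdmitsInds (K : KB NC NI) (L : Family) (n : ℕ) (v : NI → NC → ℤ) : Prop :=
  ∀ s ∈ K.abox, s.cmp.Holds (s.conc.evalZ L n (v s.ind) : ℝ) (s.bound * n)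

namespace KB

theorem lhs_names_subset {K : KB NC NI} {t : Incl NC} (ht : t ∈ K.tbox) :
    t.lhs.names ⊆ K.names := fun _ hA => ⟨t.lhs, Or.inl ⟨t, ht, Or.inl rfl⟩, hA⟩

theorem rhs_names_subset {K : KB NC NI} {t : Incl NC} (ht : t ∈ K.tbox) :
    t.rhs.names ⊆ K.names := fun _ hA => ⟨t.rhs, Or.inl ⟨t, ht, Or.inr rfl⟩, hA⟩

theorem assertion_names_subset {K : KB NC NI} {s : Assertion NC NI} (hs : s ∈ K.abox) :
    s.conc.names ⊆ K.names := fun _ hA => ⟨s.conc, Or.inr (Or.inl ⟨s, hs, rfl⟩), hA⟩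

theorem dist_names_subset {K : KB NC NI} {E : BConcept NC} (hE : E ∈ K.dist) :
    E.names ⊆ K.names := fun _ hA => ⟨E, Or.inr (Or.inr (Or.inl hE)), hA⟩

theorem typ_names_subset {K : KB NC NI} {E : BConcept NC} (hE : E ∈ K.dist)
    {p : BConcept NC × ℝ} (hp : p ∈ K.typ E) : p.1.names ⊆ K.names :=
  fun _ hA => ⟨p.1, Or.inr (Or.inr (Or.inr ⟨E, hE, p, hp, rfl⟩)), hA⟩

theorem HasDecimalWeights.weightInt_eq {K : KB NC NI} {k : ℕ} (hK : K.HasDecimalWeights k)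
    {E : BConcept NC} (hE : E ∈ K.dist) {p : BConcept NC × ℝ} (hp : p ∈ K.typ E) :
    (weightInt k p.2 : ℝ) = p.2 * 10 ^ k := by
  obtain ⟨z, hz⟩ := hK E hE p hp
  rw [weightInt, hz, round_intCast]

end KB

/-- An element satisfies the strict inclusions and the coherence condition if and only if its
integer valuation is admitted. -/
theorem Interp.local_iff_admits {n k : ℕ} (hn : 0 < n) (I : Interp.{u} NC NI n) (L : Family)
    (φ : ℝ → ℝ) {K : KB NC NI} (hK : K.HasDecimalWeights k) (x : I.Dom) (f : NC → ℤ)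
    (h : ∀ A ∈ K.names, I.conc A x = (f A : ℝ) / n) :
    ((∀ t ∈ K.tbox, t.cmp.Holds (L.impl (I.deg L t.lhs x) (I.deg L t.rhs x)) t.bound) ∧
      ∀ E ∈ K.dist, I.deg L E x = phiN φ n (∑ p ∈ K.typ E, p.2 * I.deg L p.1 x)) ↔
    K.Admits L φ n k f := by
  have hn' : (n : ℝ) ≠ 0 := by exact_mod_cast hn.ne'
  have key : ∀ E : BConcept NC, E.names ⊆ K.names → I.deg L E x = (E.evalZ L n f : ℝ) / n :=
    fun E hE => I.deg_eq_evalZ_div hn L x f E fun A hA => h A (hE hA)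
  unfold KB.Admits
  refine and_congr (forall₂_congr fun t ht => ?_) (forall₂_congr fun E hE => ?_)
  · rw [key _ (KB.lhs_names_subset ht), key _ (KB.rhs_names_subset ht), L.implZ_div hn,
      Cmp.holds_div _ hn]
  -- The denominator undoes two scalings: `10 ^ k` for the weights and `n` for the degrees.
  · have hsum : ∑ p ∈ K.typ E, p.2 * I.deg L p.1 x =
        (K.weightedSum L n k f E : ℝ) / (n * 10 ^ k) := by
      unfold KB.weightedSum
      push_cast
      rw [Finset.sum_div]
      refine Finset.sum_congr rfl fun p hp => ?_
      rw [key _ (KB.typ_names_subset hE hp), hK.weightInt_eq hE hp]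
      field_simp
    rw [hsum, key _ (KB.dist_names_subset hE), div_eq_iff hn', mul_comm (phiN _ _ _)]

/-- Inclusions and coherence quantify over elements separately, so they split into local conditions;
only the assertions refer to the interpretation of individuals. -/
theorem Interp.isModel_iff {n k : ℕ} (hn : 0 < n) (I : Interp.{u} NC NI n) (L : Family)
    (φ : ℝ → ℝ) {K : KB NC NI} (hK : K.HasDecimalWeights k) (f : I.Dom → NC → ℤ)
    (h : ∀ x, ∀ A ∈ K.names, I.conc A x = (f x A : ℝ) / n) :
    I.IsModel L (phiN φ n) K ↔
      (∀ x, K.Admits L φ n k (f x)) ∧ K.AdmitsInds L n fun a => f (I.ind a) := by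
  have habox : (∀ s ∈ K.abox, I.SatAssertion L s) ↔ K.AdmitsInds L n fun a => f (I.ind a) := by
    refine forall₂_congr fun s hs => ?_
    rw [SatAssertion, I.deg_eq_evalZ_div hn L _ (f (I.ind s.ind)) s.conc
      fun A hA => h _ A (KB.assertion_names_subset hs hA), Cmp.holds_div _ hn]
  unfold IsModel SatIncl Coherent
  rw [habox]
  constructor
  · rintro ⟨ht, ha, hc⟩
    exact ⟨fun x => (I.local_iff_admits hn L φ hK x (f x) (h x)).1
      ⟨fun t htt => ht t htt x, fun E hE => hc E hE x⟩, ha⟩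
  · rintro ⟨hf, ha⟩
    have hloc := fun x => (I.local_iff_admits hn L φ hK x (f x) (h x)).2 (hf x)
    exact ⟨fun t ht x => (hloc x).1 t ht, ha, fun E hE x => (hloc x).2 E hE⟩

theorem Interp.exists_valuation {n : ℕ} (I : Interp.{u} NC NI n) :
    ∃ f : I.Dom → NC → ℤ, (∀ x A, 0 ≤ f x A ∧ f x A ≤ n) ∧
      ∀ x A, I.conc A x = (f x A : ℝ) / n := by
  choose f hf hfe using I.conc_mem
  refine ⟨fun x A => (f A x : ℤ), fun x A => ⟨Int.natCast_nonneg _, Int.ofNat_le.2 (hf A x)⟩,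
    fun x A => ?_⟩
  rw [hfe A x, Int.cast_natCast]

/-! ### Answer sets of the encoding -/

/-- A choice head supports only atoms already in `S`, so closure under it is automatic. -/
theorem reductClosed_self {β : Type u} {P : Set (GRule β)} {S : Set β} (h : ∀ r ∈ P, r.Sat S) :
    ReductClosed P S S := by
  rintro ⟨head, pos, neg⟩ hr hneg hpos
  have hs := h _ hr hpos hneg
  cases head with
  | atom a => exact Set.singleton_subset_iff.2 hs
  | falsum => exact hs.elim
  | exactlyOne s => exact Set.inter_subset_right

/-- This serves as an induction principle: an invariant preserved by the reduct holds for every atom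
of the answer set. -/
theorem IsAnswerSet.subset {β : Type u} {P : Set (GRule β)} {S M : Set β} (h : IsAnswerSet P S)
    (hM : ReductClosed P S M) : S ⊆ M := by
  rw [h.2]
  exact Set.sInter_subset_of_mem hM

theorem ReductClosed.mem_of_rule {β : Type u} {P : Set (GRule β)} {S M : Set β}
    (hM : ReductClosed P S M) {a : β} {B : Set β} (hr : GRule.rule a B ∈ P) (hB : B ⊆ M) :
    a ∈ M :=
  hM _ hr (Set.empty_disjoint _) hB rfl

theorem ReductClosed.mem_of_fact {β : Type u} {P : Set (GRule β)} {S M : Set β}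
    (hM : ReductClosed P S M) {a : β} (hr : GRule.fact a ∈ P) : a ∈ M :=
  hM _ hr (Set.empty_disjoint _) (Set.empty_subset _) rfl

/-- The concepts about which the encoding reasons: those of `K`, `C`, `D` and their
subconcepts. -/
inductive Relevant (K : KB NC NI) (C D : BConcept NC) : BConcept NC → Prop
  | base {E : BConcept NC} (hE : E ∈ K.concepts ∨ E = C ∨ E = D) : Relevant K C D E
  | andL {E F : BConcept NC} (h : Relevant K C D (.and E F)) : Relevant K C D E
  | andR {E F : BConcept NC} (h : Relevant K C D (.and E F)) : Relevant K C D F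
  | orL {E F : BConcept NC} (h : Relevant K C D (.or E F)) : Relevant K C D E
  | orR {E F : BConcept NC} (h : Relevant K C D (.or E F)) : Relevant K C D F
  | neg {E : BConcept NC} (h : Relevant K C D (.neg E)) : Relevant K C D E

/-- The concept names occurring in the knowledge base or in the query. -/
def KB.queryNames (K : KB NC NI) (C D : BConcept NC) : Set NC := K.names ∪ C.names ∪ D.names

theorem Relevant.names_subset {K : KB NC NI} {C D E : BConcept NC} (h : Relevant K C D E) :
    E.names ⊆ K.queryNames C D := by
  induction h with
  | base hE =>
    intro A hA
    rcases hE with hE | rfl | rfl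
    · exact Or.inl (Or.inl ⟨_, hE, hA⟩)
    · exact Or.inl (Or.inr hA)
    · exact Or.inr hA
  | andL _ ih => exact fun A hA => ih (Or.inl hA)
  | andR _ ih => exact fun A hA => ih (Or.inr hA)
  | orL _ ih => exact fun A hA => ih (Or.inl hA)
  | orR _ ih => exact fun A hA => ih (Or.inr hA)
  | neg _ ih => exact ih

theorem Relevant.name {K : KB NC NI} {C D E : BConcept NC} (h : Relevant K C D E) {A : NC}
    (hA : A ∈ E.names) : Relevant K C D (.name A) := by
  induction E with
  | name B => cases hA; exact h
  | top => exact hA.elim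
  | bot => exact hA.elim
  | and E F ihE ihF => exact hA.elim (ihE h.andL) (ihF h.andR)
  | or E F ihE ihF => exact hA.elim (ihE h.orL) (ihF h.orR)
  | neg E ih => exact ih h.neg hA

/-- Evaluation of a name is guarded by `cls`, that of other concepts by `concept`; the two guards
have to agree on names. -/
theorem relevant_name_iff {K : KB NC NI} {C D : BConcept NC} {A : NC} :
    Relevant K C D (.name A) ↔ A ∈ K.queryNames C D := by
  refine ⟨fun h => h.names_subset rfl, ?_⟩
  rintro ((⟨E, hE, hA⟩ | hA) | hA)
  · exact (Relevant.base (Or.inl hE)).name hA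
  · exact (Relevant.base (Or.inr (Or.inl rfl))).name hA
  · exact (Relevant.base (Or.inr (Or.inr rfl))).name hA

/-- The constants `x` with a fact `nom(x)`. -/
def KB.IsNom (K : KB NC NI) : Const NI → Prop
  | .ind a => a ∈ K.inds
  | .aux => True

section Derivations

variable {L : Family} {φ : ℝ → ℝ} {n k : ℕ} {K : KB NC NI} {C D : BConcept NC} {θ : Cmp} {α : ℝ}
  {S M : Set (Atom NC NI)} {v : Const NI → NC → ℤ}

local notation "Prog" => encoding L φ n k K C D θ α

/-! ### Atoms forced into every set closed under the reduct -/

/-- `M` and `S` are kept apart in these lemmas for two uses: an arbitrary closed `M` for the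
minimality of the standard set, and `M = S` for an arbitrary answer set. -/
theorem ReductClosed.nom_mem (hM : ReductClosed Prog S M) {x : Const NI} (hx : K.IsNom x) :
    Atom.nom x ∈ M := by
  cases x with
  | ind a => exact hM.mem_of_fact (EncRule.nom a hx)
  | aux => exact hM.mem_of_fact EncRule.nomAux

theorem ReductClosed.cls_mem (hM : ReductClosed Prog S M) {A : NC}
    (hA : A ∈ K.queryNames C D) : Atom.cls A ∈ M :=
  hM.mem_of_fact (EncRule.cls A hA)

theorem ReductClosed.concept_mem (hM : ReductClosed Prog S M) {E : BConcept NC}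
    (hE : Relevant K C D E) : Atom.concept E ∈ M := by
  induction hE with
  | base hE => exact hM.mem_of_fact (EncRule.concept _ hE)
  | andL _ ih =>
    exact hM.mem_of_rule (EncRule.conceptAndL _ _) (Set.singleton_subset_iff.2 ih)
  | andR _ ih =>
    exact hM.mem_of_rule (EncRule.conceptAndR _ _) (Set.singleton_subset_iff.2 ih)
  | orL _ ih => exact hM.mem_of_rule (EncRule.conceptOrL _ _) (Set.singleton_subset_iff.2 ih)
  | orR _ ih => exact hM.mem_of_rule (EncRule.conceptOrR _ _) (Set.singleton_subset_iff.2 ih)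
  | neg _ ih => exact hM.mem_of_rule (EncRule.conceptNeg _) (Set.singleton_subset_iff.2 ih)

/-- `S` contains the instance atoms that `v` prescribes for the names of the encoding. -/
def InstMem (K : KB NC NI) (C D : BConcept NC) (n : ℕ) (v : Const NI → NC → ℤ)
    (S : Set (Atom NC NI)) : Prop :=
  ∀ x, K.IsNom x → ∀ A ∈ K.queryNames C D,
    0 ≤ v x A ∧ v x A ≤ n ∧ Atom.inst x A (v x A) ∈ S

/-- In the reduct the choice rule becomes a definite rule for each `inst` atom chosen in `S`, so the
choice made by `S` carries over to `M`. -/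
theorem ReductClosed.inst_mem (hM : ReductClosed Prog S M) (hv : InstMem K C D n v S)
    {x : Const NI} (hx : K.IsNom x) {A : NC} (hA : A ∈ K.queryNames C D) :
    Atom.inst x A (v x A) ∈ M := by
  obtain ⟨h0, h1, h2⟩ := hv x hx A hA
  refine hM _ (EncRule.choice A x) (Set.empty_disjoint _) ?_ ⟨⟨_, h0, h1, rfl⟩, h2⟩
  exact Set.pair_subset (hM.cls_mem hA) (hM.nom_mem hx)

theorem ReductClosed.eval_mem (hM : ReductClosed Prog S M) (hv : InstMem K C D n v S)
    {x : Const NI} (hx : K.IsNom x) {E : BConcept NC} (hE : Relevant K C D E) :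
    Atom.eval E x (E.evalZ L n (v x)) ∈ M := by
  induction E with
  | name A =>
    have hA := relevant_name_iff.1 hE
    exact hM.mem_of_rule (EncRule.evalName A x _)
      (Set.pair_subset (hM.cls_mem hA) (hM.inst_mem hv hx hA))
  | top =>
    exact hM.mem_of_rule (EncRule.evalTop x)
      (Set.pair_subset (hM.concept_mem hE) (hM.nom_mem hx))
  | bot =>
    exact hM.mem_of_rule (EncRule.evalBot x)
      (Set.pair_subset (hM.concept_mem hE) (hM.nom_mem hx))
  | and E F ihE ihF =>
    exact hM.mem_of_rule (EncRule.evalAnd E F x _ _)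
      (Set.insert_subset (hM.concept_mem hE) (Set.pair_subset (ihE hE.andL) (ihF hE.andR)))
  | or E F ihE ihF =>
    exact hM.mem_of_rule (EncRule.evalOr E F x _ _)
      (Set.insert_subset (hM.concept_mem hE) (Set.pair_subset (ihE hE.orL) (ihF hE.orR)))
  | neg E ih =>
    exact hM.mem_of_rule (EncRule.evalNeg E x _)
      (Set.pair_subset (hM.concept_mem hE) (ih hE.neg))

theorem Relevant.of_dist {E : BConcept NC} (hE : E ∈ K.dist) : Relevant K C D E :=
  .base (Or.inl (Or.inr (Or.inr (Or.inl hE))))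

theorem Relevant.of_typ {E : BConcept NC} (hE : E ∈ K.dist) {p : BConcept NC × ℝ}
    (hp : p ∈ K.typ E) : Relevant K C D p.1 :=
  .base (Or.inl (Or.inr (Or.inr (Or.inr ⟨E, hE, p, hp, rfl⟩))))

theorem ReductClosed.weight_mem (hM : ReductClosed Prog S M) (hv : InstMem K C D n v S)
    {x : Const NI} (hx : K.IsNom x) {E : BConcept NC} (hE : E ∈ K.dist) :
    Atom.weight x E (K.weightedSum L n k (v x) E) ∈ M := by
  refine hM.mem_of_rule (EncRule.weight E hE x fun p => p.1.evalZ L n (v x)) ?_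
  rintro a (rfl | ⟨p, hp, rfl | rfl⟩)
  · exact hM.nom_mem hx
  · exact hM.mem_of_fact (EncRule.subTyp E hE p hp)
  · exact hM.eval_mem hv hx (.of_typ hE hp)

theorem ReductClosed.num_mem (hM : ReductClosed Prog S M) (hv : InstMem K C D n v S)
    {x : Const NI} (hx : K.IsNom x) {E : BConcept NC} (hE : E ∈ K.dist) :
    Atom.num (K.weightedSum L n k (v x) E) ∈ M :=
  hM.mem_of_rule (EncRule.num x E _) (Set.insert_subset (hM.nom_mem hx)
    (Set.pair_subset (hM.weight_mem hv hx hE) (hM.mem_of_fact (EncRule.dcls E hE))))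

theorem ReductClosed.valphi_mem (hM : ReductClosed Prog S M) (hv : InstMem K C D n v S)
    {x : Const NI} (hx : K.IsNom x) {E : BConcept NC} (hE : E ∈ K.dist) {i : ℤ}
    (hi : (i : ℝ) = n * phiN φ n ((K.weightedSum L n k (v x) E : ℝ) / (n * 10 ^ k))) :
    Atom.valphi (K.weightedSum L n k (v x) E) i ∈ M :=
  hM.mem_of_rule (EncRule.valphi _ i hi) (Set.singleton_subset_iff.2 (hM.num_mem hv hx hE))

/-! ### The answer set built from an admitted valuation -/

variable (L φ n k K C D θ α v) in
/-- The atoms of the answer set in which the constant `x` has the valuation `v x`. -/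
def Derivable : Atom NC NI → Prop
  | .val i => 0 ≤ i ∧ i ≤ n
  | .nom x => K.IsNom x
  | .cls A => A ∈ K.queryNames C D
  | .concept E => Relevant K C D E
  | .dcls E => E ∈ K.dist
  | .subTyp E F w => E ∈ K.dist ∧ ∃ p ∈ K.typ E, p.1 = F ∧ weightInt k p.2 = w
  | .inst x A i => K.IsNom x ∧ A ∈ K.queryNames C D ∧ i = v x A
  | .eval E x i => K.IsNom x ∧ Relevant K C D E ∧ i = E.evalZ L n (v x)
  | .weight x E w => K.IsNom x ∧ E ∈ K.dist ∧ w = K.weightedSum L n k (v x) E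
  | .num w => ∃ x E, K.IsNom x ∧ E ∈ K.dist ∧ w = K.weightedSum L n k (v x) E
  | .valphi w i => (∃ x E, K.IsNom x ∧ E ∈ K.dist ∧ w = K.weightedSum L n k (v x) E) ∧
      (i : ℝ) = n * phiN φ n ((w : ℝ) / (n * 10 ^ k))
  | .auxtc x E => x = .aux ∧ E = C
  | .ok => θ.Holds (D.evalZ L n (v .aux) : ℝ) (α * n)
  | .notok => ¬ θ.Holds (D.evalZ L n (v .aux) : ℝ) (α * n)

variable (L φ n k K C D θ α v) in
/-- The answer set determined by the valuations `v`. -/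
def derivableSet : Set (Atom NC NI) := {a | Derivable L φ n k K C D θ α v a}

local notation "Std" => derivableSet L φ n k K C D θ α v

/-- The range bound serves the choice rule, and admissibility serves the three kinds of constraints;
the remaining rules preserve the description of the atoms. -/
theorem sat_derivableSet (hr : ∀ x, K.IsNom x → ∀ A, 0 ≤ v x A ∧ v x A ≤ n)
    (ha : ∀ x, K.IsNom x → K.Admits L φ n k (v x))
    (hi : K.AdmitsInds L n fun a => v (.ind a)) (r : GRule (Atom NC NI)) (hP : r ∈ Prog) :
    r.Sat Std := by
  intro hpos hneg
  have mem : ∀ a ∈ r.pos, Derivable L φ n k K C D θ α v a := fun a h => hpos h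
  cases hP with
  | val i h0 hn => exact ⟨h0, hn⟩
  | nom a ha => exact ha
  | nomAux => exact trivial
  | auxtc => exact ⟨rfl, rfl⟩
  | cls A hA => exact hA
  | dcls E hE => exact hE
  | subTyp E hE p hp => exact ⟨hE, p, hp, rfl, rfl⟩
  | concept E hE => exact .base hE
  | conceptAndL E F => exact (mem _ rfl : Relevant K C D _).andL
  | conceptAndR E F => exact (mem _ rfl : Relevant K C D _).andR
  | conceptOrL E F => exact (mem _ rfl : Relevant K C D _).orL
  | conceptOrR E F => exact (mem _ rfl : Relevant K C D _).orR
  | conceptNeg E => exact (mem _ rfl : Relevant K C D _).neg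
  | choice A x =>
    have hA : A ∈ K.queryNames C D := mem _ (Or.inl rfl)
    have hx : K.IsNom x := mem _ (Or.inr rfl)
    refine ⟨.inst x A (v x A), ⟨⟨_, (hr x hx A).1, (hr x hx A).2, rfl⟩, hx, hA, rfl⟩, ?_⟩
    rintro _ ⟨⟨i, -, -, rfl⟩, -, -, rfl⟩
    rfl
  | evalName A x i =>
    have hA : A ∈ K.queryNames C D := mem _ (Or.inl rfl)
    obtain ⟨hx, -, rfl⟩ := mem (.inst x A i) (Or.inr rfl)
    exact ⟨hx, relevant_name_iff.2 hA, rfl⟩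
  | evalTop x => exact ⟨mem (.nom x) (Or.inr rfl), mem (.concept .top) (Or.inl rfl), rfl⟩
  | evalBot x => exact ⟨mem (.nom x) (Or.inr rfl), mem (.concept .bot) (Or.inl rfl), rfl⟩
  | evalAnd E F x i j =>
    obtain ⟨hx, -, rfl⟩ := mem (.eval E x i) (Or.inr (Or.inl rfl))
    obtain ⟨-, -, rfl⟩ := mem (.eval F x j) (Or.inr (Or.inr rfl))
    exact ⟨hx, mem (.concept _) (Or.inl rfl), rfl⟩
  | evalOr E F x i j =>
    obtain ⟨hx, -, rfl⟩ := mem (.eval E x i) (Or.inr (Or.inl rfl))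
    obtain ⟨-, -, rfl⟩ := mem (.eval F x j) (Or.inr (Or.inr rfl))
    exact ⟨hx, mem (.concept _) (Or.inl rfl), rfl⟩
  | evalNeg E x i =>
    obtain ⟨hx, -, rfl⟩ := mem (.eval E x i) (Or.inr rfl)
    exact ⟨hx, mem (.concept _) (Or.inl rfl), rfl⟩
  | abox s hs i h =>
    obtain ⟨-, -, rfl⟩ := mem (.eval s.conc (.ind s.ind) i) rfl
    exact h (hi s hs)
  | tbox t ht x i j h =>
    obtain ⟨hx, -, rfl⟩ := mem (.eval t.lhs x i) (Or.inl rfl)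
    obtain ⟨-, -, rfl⟩ := mem (.eval t.rhs x j) (Or.inr rfl)
    exact h ((ha x hx).1 t ht)
  | weight E hE x V =>
    refine ⟨mem (.nom x) (Or.inl rfl), hE, Finset.sum_congr rfl fun p hp => ?_⟩
    obtain ⟨-, -, h⟩ := mem (.eval p.1 x (V p)) (Or.inr ⟨p, hp, Or.inr rfl⟩)
    rw [h]
  | num x E W =>
    obtain ⟨hx, hE, h⟩ := mem (.weight x E W) (Or.inr (Or.inl rfl))
    exact ⟨x, E, hx, hE, h⟩
  | valphi W i h => exact ⟨mem (.num W) rfl, h⟩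
  | coherence x E i j W h =>
    have hE : E ∈ K.dist := mem (.dcls E) (Or.inr (Or.inl rfl))
    obtain ⟨hx, -, rfl⟩ := mem (.eval E x i) (Or.inr (Or.inr (Or.inl rfl)))
    obtain ⟨-, -, rfl⟩ := mem (.weight x E W) (Or.inr (Or.inr (Or.inr (Or.inl rfl))))
    obtain ⟨-, hj⟩ := mem (.valphi _ j) (Or.inr (Or.inr (Or.inr (Or.inr rfl))))
    have := (ha x hx).2 E hE
    rw [← hj] at this
    exact h (by exact_mod_cast this)
  | ok i h =>
    obtain ⟨-, -, rfl⟩ := mem (.eval D .aux i) rfl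
    exact h
  | notok => exact fun h => Set.disjoint_left.1 hneg (rfl : Atom.ok ∈ {Atom.ok}) h

theorem isAnswerSet_derivableSet (hr : ∀ x, K.IsNom x → ∀ A, 0 ≤ v x A ∧ v x A ≤ n)
    (ha : ∀ x, K.IsNom x → K.Admits L φ n k (v x))
    (hi : K.AdmitsInds L n fun a => v (.ind a)) : IsAnswerSet Prog Std := by
  have hsat := sat_derivableSet (C := C) (D := D) (θ := θ) (α := α) hr ha hi
  have hv : InstMem K C D n v Std :=
    fun x hx A hA => ⟨(hr x hx A).1, (hr x hx A).2, hx, hA, rfl⟩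
  refine ⟨hsat, Set.Subset.antisymm (Set.subset_sInter fun M hM a h => ?_)
    (Set.sInter_subset_of_mem (reductClosed_self hsat))⟩
  have hM' : ReductClosed Prog Std M := hM
  have haD : Derivable L φ n k K C D θ α v a := h
  have hD : Relevant K C D D := .base (Or.inr (Or.inr rfl))
  cases a with
  | val i => exact hM'.mem_of_fact (EncRule.val i haD.1 haD.2)
  | nom x => exact hM'.nom_mem haD
  | cls A => exact hM'.cls_mem haD
  | concept E => exact hM'.concept_mem haD
  | dcls E => exact hM'.mem_of_fact (EncRule.dcls E haD)
  | subTyp E F w =>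
    obtain ⟨hE, p, hp, rfl, rfl⟩ := haD
    exact hM'.mem_of_fact (EncRule.subTyp E hE p hp)
  | inst x A i =>
    obtain ⟨hx, hA, rfl⟩ := haD
    exact hM'.inst_mem hv hx hA
  | eval E x i =>
    obtain ⟨hx, hE, rfl⟩ := haD
    exact hM'.eval_mem hv hx hE
  | weight x E w =>
    obtain ⟨hx, hE, rfl⟩ := haD
    exact hM'.weight_mem hv hx hE
  | num w =>
    obtain ⟨x, E, hx, hE, rfl⟩ := haD
    exact hM'.num_mem hv hx hE
  | valphi w i =>
    obtain ⟨⟨x, E, hx, hE, rfl⟩, h⟩ := haD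
    exact hM'.valphi_mem hv hx hE h
  | auxtc x E =>
    obtain ⟨rfl, rfl⟩ := haD
    exact hM'.mem_of_fact EncRule.auxtc
  | ok =>
    exact hM'.mem_of_rule (EncRule.ok _ haD)
      (Set.singleton_subset_iff.2 (hM'.eval_mem hv (x := .aux) trivial hD))
  | notok =>
    -- The rule survives in the reduct because `ok` is absent from the standard set; whether `ok`
    -- lies in `M` is irrelevant.
    refine hM' _ EncRule.notok ?_ (Set.empty_subset _) rfl
    exact Set.disjoint_singleton_left.2 haD

/-! ### From answer sets back to valuations -/

/-- Every answer set of the encoding determines admitted valuations of the constants, and these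
determine its `eval` atoms. -/
theorem IsAnswerSet.exists_valuation (hn : 0 < n) (hS : IsAnswerSet Prog S) :
    ∃ v : Const NI → NC → ℤ, (∀ x A, 0 ≤ v x A ∧ v x A ≤ n) ∧
      (∀ x, K.IsNom x → K.Admits L φ n k (v x)) ∧
      K.AdmitsInds L n (fun a => v (.ind a)) ∧
      (∀ E x i, Atom.eval E x i ∈ S → i = E.evalZ L n (v x)) ∧
      (∀ E x, K.IsNom x → Relevant K C D E → Atom.eval E x (E.evalZ L n (v x)) ∈ S) ∧
      (∀ E, Atom.auxtc .aux E ∈ S → E = C) ∧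
      (Atom.ok ∈ S → θ.Holds (D.evalZ L n (v .aux) : ℝ) (α * n)) ∧
      (Atom.ok ∉ S → Atom.notok ∈ S) := by
  classical
  have hSS := reductClosed_self hS.1
  -- The valuation is made total: it is the chosen value where the choice rule fires, and `0`
  -- elsewhere.
  have hex : ∀ x A, ∃ i : ℤ, 0 ≤ i ∧ i ≤ n ∧ (Atom.cls A ∈ S → Atom.nom x ∈ S →
      Atom.inst x A i ∈ S ∧ ∀ j : ℤ, 0 ≤ j → j ≤ n → Atom.inst x A j ∈ S → j = i) := by
    intro x A
    by_cases h : Atom.cls A ∈ S ∧ Atom.nom x ∈ S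
    · obtain ⟨_, ⟨⟨i, h0, h1, rfl⟩, hi⟩, hu⟩ :=
        hS.1 _ (EncRule.choice A x) (Set.pair_subset h.1 h.2) (Set.empty_disjoint _)
      refine ⟨i, h0, h1, fun _ _ => ⟨hi, fun j hj0 hj1 hj => ?_⟩⟩
      have := hu (.inst x A j) ⟨⟨j, hj0, hj1, rfl⟩, hj⟩
      cases this
      rfl
    · exact ⟨0, le_rfl, by positivity, fun h1 h2 => (h ⟨h1, h2⟩).elim⟩
  choose v hv0 hv1 hv using hex
  have hinst : InstMem K C D n v S := fun x hx A hA =>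
    ⟨hv0 x A, hv1 x A, (hv x A (hSS.cls_mem hA) (hSS.nom_mem hx)).1⟩
  -- The invariant says that `eval` atoms carry only the value computed from `v`. Its clauses for
  -- `nom` and `cls` give membership in `S`, since uniqueness of the chosen `inst` atom is known
  -- only there.
  let Q : Atom NC NI → Prop := fun a => match a with
    | .nom x => Atom.nom x ∈ S
    | .cls A => Atom.cls A ∈ S
    | .inst x A i => i = v x A
    | .eval E x i => i = E.evalZ L n (v x)
    | .auxtc _ E => E = C
    | .ok => θ.Holds (D.evalZ L n (v .aux) : ℝ) (α * n)
    | _ => True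
  have hQ : ReductClosed Prog S {a | Q a} := by
    intro r hr _ hpos
    have mem : ∀ a ∈ r.pos, Q a := fun a h => hpos h
    cases hr with
    | nom a ha => rintro _ rfl; exact hSS.mem_of_fact (EncRule.nom a ha)
    | nomAux => rintro _ rfl; exact hSS.mem_of_fact EncRule.nomAux
    | cls A hA => rintro _ rfl; exact hSS.mem_of_fact (EncRule.cls A hA)
    | choice A x =>
      rintro _ ⟨⟨i, h0, h1, rfl⟩, hi⟩
      exact (hv x A (mem _ (Or.inl rfl)) (mem _ (Or.inr rfl))).2 i h0 h1 hi
    | evalName A x i => rintro _ rfl; exact mem (.inst x A i) (Or.inr rfl)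
    | evalAnd E F x i j =>
      rintro _ rfl
      have h1 : i = _ := mem (.eval E x i) (Or.inr (Or.inl rfl))
      have h2 : j = _ := mem (.eval F x j) (Or.inr (Or.inr rfl))
      rw [h1, h2]
      rfl
    | evalOr E F x i j =>
      rintro _ rfl
      have h1 : i = _ := mem (.eval E x i) (Or.inr (Or.inl rfl))
      have h2 : j = _ := mem (.eval F x j) (Or.inr (Or.inr rfl))
      rw [h1, h2]
      rfl
    | evalNeg E x i =>
      rintro _ rfl
      have h1 : i = _ := mem (.eval E x i) (Or.inr rfl)
      rw [h1]
      rfl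
    | ok i h =>
      rintro _ rfl
      have h1 : i = _ := mem (.eval D .aux i) rfl
      rw [h1] at h
      exact h
    | abox | tbox | coherence => rintro _ ⟨⟩
    | _ => rintro _ rfl; first | exact trivial | exact rfl
  have hSQ := hS.subset hQ
  refine ⟨v, fun x A => ⟨hv0 x A, hv1 x A⟩, fun x hx => ⟨fun t ht => ?_, fun E hE => ?_⟩,
    fun s hs => ?_, fun E x i h => hSQ h, fun E x hx hE => hSS.eval_mem hinst hx hE,
    fun E h => hSQ h, fun h => hSQ h, fun h => ?_⟩
  · by_contra hc
    refine hS.1 _ (EncRule.tbox t ht x _ _ hc) (Set.pair_subset ?_ ?_) (Set.empty_disjoint _)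
    · exact hSS.eval_mem hinst hx (.base (Or.inl (Or.inl ⟨t, ht, Or.inl rfl⟩)))
    · exact hSS.eval_mem hinst hx (.base (Or.inl (Or.inl ⟨t, ht, Or.inr rfl⟩)))
  · obtain ⟨i, hi⟩ := exists_int_eq_mul_phiN φ hn
      ((K.weightedSum L n k (v x) E : ℝ) / (n * 10 ^ k))
    rw [← hi]
    by_contra hc
    refine hS.1 _ (EncRule.coherence x E (E.evalZ L n (v x)) i (K.weightedSum L n k (v x) E)
      fun h => hc (by rw [h])) ?_ (Set.empty_disjoint _)
    exact Set.insert_subset (hSS.nom_mem hx) <|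
      Set.insert_subset (hSS.mem_of_fact (EncRule.dcls E hE)) <|
      Set.insert_subset (hSS.eval_mem hinst hx (.of_dist hE)) <|
      Set.pair_subset (hSS.weight_mem hinst hx hE) (hSS.valphi_mem hinst hx hE hi)
  · by_contra hc
    refine hS.1 _ (EncRule.abox s hs _ hc) (Set.singleton_subset_iff.2 ?_) (Set.empty_disjoint _)
    exact hSS.eval_mem hinst (x := .ind s.ind) ⟨s, hs, rfl⟩
      (.base (Or.inl (Or.inr (Or.inl ⟨s, hs, rfl⟩))))
  · exact hSS _ EncRule.notok (Set.disjoint_singleton_left.2 h) (Set.empty_subset _) rfl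

end Derivations

/-! ### The canonical model -/

theorem BConcept.names_finite (E : BConcept NC) : E.names.Finite := by
  induction E with
  | name A => exact Set.finite_singleton A
  | top => exact Set.finite_empty
  | bot => exact Set.finite_empty
  | and E F ihE ihF => exact ihE.union ihF
  | or E F ihE ihF => exact ihE.union ihF
  | neg E ih => exact ih

theorem KB.concepts_finite (K : KB NC NI) : K.concepts.Finite := by
  refine (((K.tbox.finite_toSet.biUnion fun i _ => Set.toFinite {i.lhs, i.rhs}).union
    (K.abox.finite_toSet.image Assertion.conc)).union (K.dist.finite_toSet.union
    (K.dist.finite_toSet.biUnion fun E _ => (K.typ E).finite_toSet.image Prod.fst))).subset ?_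
  rintro E (⟨i, hi, h⟩ | ⟨a, ha, rfl⟩ | h | ⟨F, hF, p, hp, rfl⟩)
  · exact Or.inl (Or.inl (Set.mem_biUnion hi h))
  · exact Or.inl (Or.inr ⟨a, ha, rfl⟩)
  · exact Or.inr (Or.inl h)
  · exact Or.inr (Or.inr (Set.mem_biUnion hF ⟨p, hp, rfl⟩))

theorem KB.names_finite (K : KB NC NI) : K.names.Finite := by
  refine (K.concepts_finite.biUnion fun E _ => E.names_finite).subset ?_
  rintro A ⟨E, hE, hA⟩
  exact Set.mem_biUnion hE hA

/-- Including the names of the query lets the canonical model also prescribe the value of `D`, which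
may use names outside `K`. -/
theorem KB.queryNames_finite (K : KB NC NI) (C D : BConcept NC) :
    (K.queryNames C D).Finite :=
  (K.names_finite.union C.names_finite).union D.names_finite

/-- This permits truncating a valuation to a finite set containing the names of `K`. -/
theorem KB.Admits.congr {K : KB NC NI} {L : Family} {φ : ℝ → ℝ} {n k : ℕ} {f g : NC → ℤ}
    (hf : K.Admits L φ n k f) (h : ∀ A ∈ K.names, f A = g A) : K.Admits L φ n k g := by
  have key : ∀ E : BConcept NC, E.names ⊆ K.names → E.evalZ L n g = E.evalZ L n f :=
    fun E hE => (E.evalZ_congr L n fun A hA => h A (hE hA)).symm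
  refine ⟨fun t ht => ?_, fun E hE => ?_⟩
  · rw [key _ (lhs_names_subset ht), key _ (rhs_names_subset ht)]
    exact hf.1 t ht
  · have : K.weightedSum L n k g E = K.weightedSum L n k f E :=
      Finset.sum_congr rfl fun p hp => by rw [key _ (typ_names_subset hE hp)]
    rw [key _ (dist_names_subset hE), this]
    exact hf.2 E hE

/-- If the assertions are admitted by some admitted valuations of the individuals, there is a
canonical model that realizes exactly the admitted valuations of a finite set of names. -/
theorem exists_canonical {n k : ℕ} (hn : 0 < n) (L : Family) (φ : ℝ → ℝ) {K : KB NC NI}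
    (hK : K.HasDecimalWeights k) {R : Set NC} (hR : R.Finite) (hKR : K.names ⊆ R)
    (v : Const NI → NC → ℤ) (hr : ∀ x A, 0 ≤ v x A ∧ v x A ≤ n)
    (ha : ∀ x, K.IsNom x → K.Admits L φ n k (v x))
    (hi : K.AdmitsInds L n fun a => v (.ind a)) :
    ∃ I : Interp.{u} NC NI n, I.IsCanonical L (phiN φ n) K ∧
      ∃ x : I.Dom, ∀ A ∈ R, I.conc A x = (v .aux A : ℝ) / n := by
  classical
  have := hR.to_subtype
  let ext : (R → Fin (n + 1)) → NC → ℤ := fun t A =>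
    if h : A ∈ R then ((t ⟨A, h⟩ : ℕ) : ℤ) else 0
  have hext : ∀ t A, 0 ≤ ext t A ∧ ext t A ≤ n := by
    intro t A
    simp only [ext]
    split_ifs with h
    · have := (t ⟨A, h⟩).is_lt
      omega
    · omega
  have hsurj : ∀ f : NC → ℤ, (∀ A, 0 ≤ f A ∧ f A ≤ n) → ∃ t, ∀ A ∈ R, ext t A = f A := by
    intro f hf
    refine ⟨fun A => ⟨(f A).toNat, by have := hf A; omega⟩, fun A hA => ?_⟩
    have := hf A
    simp only [ext, hA, dif_pos]
    omega
  let T := {t : R → Fin (n + 1) // K.Admits L φ n k (ext t)}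
  have hT : ∀ f : NC → ℤ, (∀ A, 0 ≤ f A ∧ f A ≤ n) → K.Admits L φ n k f →
      ∃ t : T, ∀ A ∈ R, ext t.1 A = f A := by
    intro f hf hA
    obtain ⟨t, ht⟩ := hsurj f hf
    exact ⟨⟨t, hA.congr fun A hA => (ht A (hKR hA)).symm⟩, ht⟩
  -- Individuals that do not occur in `K` need not have an admitted valuation under `v`; they are
  -- sent to the element of `aux_C`.
  have hTx : ∀ x, ∃ t : T, K.IsNom x → ∀ A ∈ R, ext t.1 A = v x A := by
    intro x
    by_cases hx : K.IsNom x
    · obtain ⟨t, ht⟩ := hT (v x) (hr x) (ha x hx)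
      exact ⟨t, fun _ => ht⟩
    · obtain ⟨t, -⟩ := hT (v .aux) (hr _) (ha .aux trivial)
      exact ⟨t, fun h => (hx h).elim⟩
  choose τ hτ using hTx
  -- The admitted valuations live in the universe of `NC`, while the domain must lie in the universe
  -- `u` of the competing models; countability allows the transfer.
  have : Small.{u} T := Countable.toSmall T
  let e : T ≃ Shrink.{u} T := equivShrink.{u} T
  let I : Interp.{u} NC NI n :=
    { Dom := Shrink.{u} T
      dom_nonempty := ⟨e (τ .aux)⟩
      ind := fun a => e (τ (.ind a))
      conc := fun A x => (ext (e.symm x).1 A : ℝ) / n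
      conc_mem := fun A x => by
        obtain ⟨h0, h1⟩ := hext (e.symm x).1 A
        refine ⟨(ext (e.symm x).1 A).toNat, by omega, ?_⟩
        congr 1
        exact_mod_cast (Int.toNat_of_nonneg h0).symm }
  refine ⟨I, ⟨?_, fun J hJ y => ?_⟩, e (τ .aux), fun A hA => ?_⟩
  · rw [I.isModel_iff hn L φ hK (fun x => ext (e.symm x).1) fun _ _ _ => rfl]
    refine ⟨fun x => (e.symm x).2, fun s hs => ?_⟩
    have h : s.conc.evalZ L n (ext (e.symm (I.ind s.ind)).1) =
        s.conc.evalZ L n (v (.ind s.ind)) := by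
      refine s.conc.evalZ_congr L n fun A hA => ?_
      simp only [I, Equiv.symm_apply_apply]
      exact hτ (.ind s.ind) ⟨s, hs, rfl⟩ A (hKR (KB.assertion_names_subset hs hA))
    rw [h]
    exact hi s hs
  · obtain ⟨f, hf, hfe⟩ := J.exists_valuation
    obtain ⟨t, ht⟩ := hT (f y) (hf y)
      (((J.isModel_iff hn L φ hK f fun x A _ => hfe x A).1 hJ).1 y)
    refine ⟨e t, fun B hB => ?_⟩
    simp only [I, Equiv.symm_apply_apply]
    rw [ht B (hKR hB), hfe]
  · simp only [I, Equiv.symm_apply_apply]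
    rw [hτ .aux trivial A hA]

end MVDL

/-! ### Falsification in canonical models and preferred answer sets -/

theorem proposition2 {NC : Type v} {NI : Type w} (L : MVDL.Family)
    (φ : ℝ → ℝ) (hφ : ∀ x, φ x ∈ Set.Icc (0 : ℝ) 1) (hmono : Monotone φ)
    (n : ℕ) (hn : 1 ≤ n) (k : ℕ)
    (K : MVDL.KB NC NI) (hK : K.HasDecimalWeights k)
    (C D : MVDL.BConcept NC) (θ : MVDL.Cmp) (α : ℝ) (hα : α ∈ Set.Icc (0 : ℝ) 1)
    (hC : C.names ⊆ K.names)
    (hpos : (∃ I : MVDL.Interp.{u} NC NI n, I.IsModel L (MVDL.phiN φ n) K) →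
      ∃ I : MVDL.Interp.{u} NC NI n, I.IsModel L (MVDL.phiN φ n) K ∧
        ∃ x : I.Dom, 0 < I.deg L C x) :
    ((∃ I : MVDL.Interp.{u} NC NI n,
        I.IsCanonical L (MVDL.phiN φ n) K ∧ ¬ I.SatTypIncl L C D θ α) ↔
      ∃ S : Set (MVDL.Atom NC NI),
        MVDL.IsPreferred (MVDL.encoding L φ n k K C D θ α) S ∧
          ∃ i : ℤ, MVDL.Atom.eval D .aux i ∈ S ∧ ¬ θ.Holds (i : ℝ) (α * n)) ∧
    (∀ S : Set (MVDL.Atom NC NI),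
      MVDL.IsPreferred (MVDL.encoding L φ n k K C D θ α) S →
        (∃ i : ℤ, MVDL.Atom.eval D .aux i ∈ S ∧ ¬ θ.Holds (i : ℝ) (α * n)) →
          MVDL.Atom.notok ∈ S) := by
  have hn0 : 0 < n := hn
  have hn' : (0 : ℝ) < n := by exact_mod_cast hn0
  have hCrel : MVDL.Relevant K C D C := .base (Or.inr (Or.inl rfl))
  have hDrel : MVDL.Relevant K C D D := .base (Or.inr (Or.inr rfl))
  refine ⟨⟨?_, ?_⟩, ?_⟩
  · rintro ⟨I, ⟨hI, hcan⟩, hsat⟩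
    simp only [MVDL.Interp.SatTypIncl, not_forall] at hsat
    obtain ⟨x, hx, hxD⟩ := hsat
    obtain ⟨f, hf, hfe⟩ := I.exists_valuation
    obtain ⟨hadm, hadmI⟩ := (I.isModel_iff hn0 L φ hK f fun x A _ => hfe x A).1 hI
    -- The falsifying typical element plays the role of `aux_C`.
    let v : MVDL.Const NI → NC → ℤ := fun c => match c with
      | .ind a => f (I.ind a)
      | .aux => f x
    have hS : MVDL.IsAnswerSet (MVDL.encoding L φ n k K C D θ α)
        (MVDL.derivableSet L φ n k K C D θ α v) :=
      MVDL.isAnswerSet_derivableSet (fun c _ A => by cases c <;> exact hf _ A)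
        (fun c _ => by cases c <;> exact hadm _) hadmI
    refine ⟨_, ⟨hS, ?_⟩, D.evalZ L n (f x), ⟨trivial, hDrel, rfl⟩, ?_⟩
    · rintro ⟨S', hS', E, hE, i, j, hi, hj, hij⟩
      obtain ⟨v', hr', ha', hi', hev, -, haux, -⟩ := hS'.exists_valuation hn0
      obtain rfl := haux E hE
      obtain ⟨-, -, rfl⟩ := hj
      obtain rfl := hev _ _ _ hi
      -- A better answer set yields a model with an element of higher degree in `C`. Canonicity of
      -- `I` copies that element on the names of `K`, which suffice for `C`, contradicting
      -- typicality of `x`.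
      obtain ⟨J, hJ, y, hy⟩ := MVDL.exists_canonical.{u} hn0 L φ hK K.names_finite subset_rfl
        v' hr' ha' hi'
      obtain ⟨z, hz⟩ := hcan J hJ.1 y
      have hzC := I.deg_eq_evalZ_div hn0 L z (v' .aux) E fun A hA => by
        rw [hz A (hC hA), hy A (hC hA)]
      have hlt : I.Pref L E z x := by
        rw [MVDL.Interp.Pref, hzC, I.deg_eq_evalZ_div hn0 L x (f x) E fun A _ => hfe x A, gt_iff_lt,
          div_lt_div_iff_of_pos_right hn']
        exact_mod_cast hij
      exact hx.2 ⟨z, hx.1.trans hlt, hlt⟩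
    · rwa [I.deg_eq_evalZ_div hn0 L x (f x) D fun A _ => hfe x A,
        MVDL.Cmp.holds_div _ hn0] at hxD
  · rintro ⟨S, ⟨hS, hbest⟩, i, hi, hiD⟩
    obtain ⟨v, hr, ha, hinds, hev, hmem, -⟩ := hS.exists_valuation hn0
    obtain rfl := hev _ _ _ hi
    obtain ⟨I, hI, x, hx⟩ := MVDL.exists_canonical.{u} hn0 L φ hK (K.queryNames_finite C D)
      (fun A hA => Or.inl (Or.inl hA)) v hr ha hinds
    -- Any element of any model can be placed at `aux_C`, so preference of `S` bounds the degree of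
    -- `C` in all models at once.
    have hmax : ∀ J : MVDL.Interp.{u} NC NI n, J.IsModel L (MVDL.phiN φ n) K → ∀ y : J.Dom,
        J.deg L C y ≤ (C.evalZ L n (v .aux) : ℝ) / n := by
      intro J hJ y
      obtain ⟨f, hf, hfe⟩ := J.exists_valuation
      obtain ⟨hadm, hadmI⟩ := (J.isModel_iff hn0 L φ hK f fun x A _ => hfe x A).1 hJ
      let v' : MVDL.Const NI → NC → ℤ := fun c => match c with
        | .ind a => f (J.ind a)
        | .aux => f y
      have hS' : MVDL.IsAnswerSet (MVDL.encoding L φ n k K C D θ α)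
          (MVDL.derivableSet L φ n k K C D θ α v') :=
        MVDL.isAnswerSet_derivableSet (fun c _ A => by cases c <;> exact hf _ A)
          (fun c _ => by cases c <;> exact hadm _) hadmI
      rw [J.deg_eq_evalZ_div hn0 L y (f y) C fun A _ => hfe y A]
      by_contra hlt
      rw [not_le, div_lt_div_iff_of_pos_right hn'] at hlt
      exact hbest ⟨_, hS', C, ⟨rfl, rfl⟩, C.evalZ L n (f y), C.evalZ L n (v .aux),
        ⟨trivial, hCrel, rfl⟩, hmem C .aux trivial hCrel, by exact_mod_cast hlt⟩
    have hxC := I.deg_eq_evalZ_div hn0 L x (v .aux) C fun A hA => hx A (Or.inl (Or.inr hA))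
    refine ⟨I, hI, fun hsat => hiD ?_⟩
    -- The element with positive degree may lie in another model `J`; `hmax` transfers positivity to
    -- `x`.
    obtain ⟨J, hJ, y, hy⟩ := hpos ⟨I, hI.1⟩
    have hDx := hsat x ⟨hxC ▸ hy.trans_le (hmax J hJ y), ?_⟩
    · rwa [I.deg_eq_evalZ_div hn0 L x (v .aux) D fun A hA => hx A (Or.inr hA),
        MVDL.Cmp.holds_div _ hn0] at hDx
    · rintro ⟨z, -, hz⟩
      exact absurd (hmax I hI.1 z) (not_le.2 (hxC ▸ hz))
  · rintro S ⟨hS, -⟩ ⟨i, hi, hiD⟩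
    obtain ⟨v, -, -, -, hev, -, -, hok, hnotok⟩ := hS.exists_valuation hn0
    obtain rfl := hev _ _ _ hi
    -- `D` has a single value at `aux_C`, so a value violating the bound rules out `ok`.
    exact hnotok fun h => hiD (hok h)
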